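/- Let $\Omega\subset\mathbb{R}^3$ be a bounded open set with Lipschitz boundary: every $x_0\in\partial\Omega$ has an open neighbourhood $V$ such that, in suitable orthonormal coordinates $y=(y_1,y_2,y_3)$ and for some Lipschitz function $g:\mathbb{R}^2\to\mathbb{R}$, $\partial\Omega\cap V=\{y\in V: y_3=g(y_1,y_2)\}$ and $\Omega\cap V=\{y\in V: y_3>g(y_1,y_2)\}$. Let $1<p<\infty$ and let $$W^p(\mathrm{div};\Omega)=\{\mathbf u\in L^p(\Omega)^3:\ \nabla\cdot\mathbf u\in L^p(\Omega)\},\qquad \|\mathbf u\|_{W^p(\mathrm{div};\Omega)}=\|\mathbf u\|_{L^p(\Omega)}+\|\nabla\cdot\mathbf u\|_{L^p(\Omega)},$$ where the divergence is taken in the sense of distributions on $\Omega$. Let $C^\infty(\overline\Omega)^3$ denote the set of restrictions to $\overline\Omega$ of $C^\infty$ vector fields $\mathbb{R}^3\to\mathbb{R}^3$. Then $C^\infty(\overline\Omega)^3$ is contained in $W^p(\mathrm{div};\Omega)$ and is dense in it. -/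

import Mathlib

open MeasureTheory Set
open scoped ENNReal NNReal ContDiff

noncomputable section

/-- Three-dimensional Euclidean space. -/
abbrev E3 : Type := EuclideanSpace ℝ (Fin 3)

/-- The first two coordinates of a point of `ℝ³`. -/
def horiz (y : E3) : EuclideanSpace ℝ (Fin 2) := !₂[y 0, y 1]

/-- `Ω` has a Lipschitz boundary: near each boundary point, in suitable orthonormal coordinates
`y = e x`, the boundary is the graph of a Lipschitz function `g` of the first two coordinates, and
`Ω` is the part lying strictly above that graph. -/
def HasLipschitzBoundary (Ω : Set E3) : Prop :=
  ∀ x₀ ∈ frontier Ω, ∃ V : Set E3, IsOpen V ∧ x₀ ∈ V ∧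
    ∃ (e : E3 ≃ₗᵢ[ℝ] E3) (K : ℝ≥0) (g : EuclideanSpace ℝ (Fin 2) → ℝ), LipschitzWith K g ∧
      Ω ∩ V = {x | g (horiz (e x)) < e x 2} ∩ V ∧
      frontier Ω ∩ V = {x | g (horiz (e x)) = e x 2} ∩ V

/-- `φ ∈ C₀^∞(Ω)`, the scalar test functions on `Ω`. -/
def IsTestFunction (Ω : Set E3) (φ : E3 → ℝ) : Prop :=
  ContDiff ℝ ∞ φ ∧ HasCompactSupport φ ∧ tsupport φ ⊆ Ω

/-- `d` is the divergence of `u` on `Ω` in the sense of distributions. -/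
def IsWeakDiv (Ω : Set E3) (u : E3 → E3) (d : E3 → ℝ) : Prop :=
  ∀ φ : E3 → ℝ, IsTestFunction Ω φ →
    ∫ x in Ω, inner ℝ (u x) (gradient φ x) = - ∫ x in Ω, d x * φ x

/-- `L^p(Ω)^3`. -/
abbrev LpField (p : ℝ≥0∞) (Ω : Set E3) := Lp E3 p (volume.restrict Ω)

/-- `L^p(Ω)`. -/
abbrev LpScalar (p : ℝ≥0∞) (Ω : Set E3) := Lp ℝ p (volume.restrict Ω)

theorem IsTestFunction.integrable_div {p : ℝ≥0∞} [Fact (1 ≤ p)] {Ω : Set E3} {φ : E3 → ℝ}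
    (hφ : IsTestFunction Ω φ) (d : LpScalar p Ω) :
    Integrable (fun x => d x * φ x) (volume.restrict Ω) :=
  ((Lp.memLp d).locallyIntegrable Fact.out).integrable_smul_right_of_hasCompactSupport
    hφ.1.continuous hφ.2.1

theorem IsTestFunction.integrable_grad {p : ℝ≥0∞} [Fact (1 ≤ p)] {Ω : Set E3} {φ : E3 → ℝ}
    (hφ : IsTestFunction Ω φ) (u : LpField p Ω) :
    Integrable (fun x => inner ℝ (u x) (gradient φ x)) (volume.restrict Ω) := by
  have hc : Continuous (gradient φ) :=
    (InnerProductSpace.toDual ℝ E3).symm.continuous.comp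
      (hφ.1.continuous_fderiv (by simp))
  have hs : HasCompactSupport (gradient φ) :=
    (hφ.2.1.fderiv ℝ).comp_left (g := (InnerProductSpace.toDual ℝ E3).symm) (map_zero _)
  have hl : LocallyIntegrable (fun x => ‖u x‖) (volume.restrict Ω) :=
    (Lp.memLp u).norm.locallyIntegrable Fact.out
  have hb : Integrable (fun x => ‖u x‖ * ‖gradient φ x‖) (volume.restrict Ω) :=
    hl.integrable_smul_right_of_hasCompactSupport hc.norm hs.norm
  refine hb.mono' ((Lp.aestronglyMeasurable u).inner hc.aestronglyMeasurable) ?_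
  exact Filter.Eventually.of_forall fun x => norm_inner_le_norm _ _

/-- The space `W^p(div; Ω)` of all `u ∈ L^p(Ω)^3` whose distributional divergence lies in `L^p(Ω)`.
An element is stored as the pair `(u, div u)`, so that the norm inherited from the `ℓ¹`-product is
`‖u‖_{L^p} + ‖div u‖_{L^p}`; for open `Ω` the second entry is determined by the first. -/
def WpDiv (p : ℝ≥0∞) [Fact (1 ≤ p)] (Ω : Set E3) :
    Submodule ℝ (WithLp 1 (LpField p Ω × LpScalar p Ω)) where
  carrier := {w | IsWeakDiv Ω w.fst w.snd}
  zero_mem' := by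
    intro φ _
    have h₁ : ∫ x in Ω, inner ℝ ((0 : LpField p Ω) x) (gradient φ x) = 0 := by
      rw [← integral_zero E3 ℝ (μ := volume.restrict Ω)]
      refine integral_congr_ae ?_
      filter_upwards [Lp.coeFn_zero E3 p (volume.restrict Ω)] with x hx
      rw [hx, Pi.zero_apply, inner_zero_left]
    have h₂ : ∫ x in Ω, (0 : LpScalar p Ω) x * φ x = 0 := by
      rw [← integral_zero E3 ℝ (μ := volume.restrict Ω)]
      refine integral_congr_ae ?_
      filter_upwards [Lp.coeFn_zero ℝ p (volume.restrict Ω)] with x hx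
      rw [hx, Pi.zero_apply, zero_mul]
    rw [WithLp.zero_fst, WithLp.zero_snd, h₁, h₂, neg_zero]
  add_mem' := by
    intro v w hv hw φ hφ
    have h₁ : ∫ x in Ω, inner ℝ ((v.fst + w.fst) x) (gradient φ x) =
        (∫ x in Ω, inner ℝ (v.fst x) (gradient φ x)) +
          ∫ x in Ω, inner ℝ (w.fst x) (gradient φ x) := by
      rw [← integral_add (hφ.integrable_grad v.fst) (hφ.integrable_grad w.fst)]
      refine integral_congr_ae ?_
      filter_upwards [Lp.coeFn_add v.fst w.fst] with x hx
      rw [hx, Pi.add_apply, inner_add_left]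
    have h₂ : ∫ x in Ω, (v.snd + w.snd) x * φ x =
        (∫ x in Ω, v.snd x * φ x) + ∫ x in Ω, w.snd x * φ x := by
      rw [← integral_add (hφ.integrable_div v.snd) (hφ.integrable_div w.snd)]
      refine integral_congr_ae ?_
      filter_upwards [Lp.coeFn_add v.snd w.snd] with x hx
      rw [hx, Pi.add_apply, add_mul]
    rw [WithLp.add_fst, WithLp.add_snd, h₁, h₂, hv φ hφ, hw φ hφ, neg_add]
  smul_mem' := by
    intro c w hw φ hφ
    have h₁ : ∫ x in Ω, inner ℝ ((c • w.fst) x) (gradient φ x) =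
        c * ∫ x in Ω, inner ℝ (w.fst x) (gradient φ x) := by
      rw [← integral_const_mul]
      refine integral_congr_ae ?_
      filter_upwards [Lp.coeFn_smul c w.fst] with x hx
      rw [hx, Pi.smul_apply, real_inner_smul_left]
    have h₂ : ∫ x in Ω, (c • w.snd) x * φ x = c * ∫ x in Ω, w.snd x * φ x := by
      rw [← integral_const_mul]
      refine integral_congr_ae ?_
      filter_upwards [Lp.coeFn_smul c w.snd] with x hx
      rw [hx, Pi.smul_apply, smul_eq_mul, mul_assoc]
    rw [WithLp.smul_fst, WithLp.smul_snd, h₁, h₂, hw φ hφ, mul_neg]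

namespace WpDiv

variable {p : ℝ≥0∞} [Fact (1 ≤ p)] {Ω : Set E3}

/-- The vector field `u ∈ L^p(Ω)^3` underlying an element of `W^p(div; Ω)`. -/
def field (w : WpDiv p Ω) : LpField p Ω := w.1.fst

/-- The weak divergence `div u ∈ L^p(Ω)`. -/
def div (w : WpDiv p Ω) : LpScalar p Ω := w.1.snd

theorem isWeakDiv (w : WpDiv p Ω) : IsWeakDiv Ω (field w) (div w) := w.2

theorem norm_eq (w : WpDiv p Ω) : ‖w‖ = ‖field w‖ + ‖div w‖ :=
  WithLp.prod_norm_eq_of_L1 (w : WithLp 1 (LpField p Ω × LpScalar p Ω))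

/-- On an open set the weak divergence is determined by the field. -/
theorem field_injective (hΩ : IsOpen Ω) :
    Function.Injective (field : WpDiv p Ω → LpField p Ω) := by
  intro v w h
  have hli : LocallyIntegrable (fun x => div v x - div w x) (volume.restrict Ω) :=
    ((Lp.memLp (div v)).locallyIntegrable Fact.out).sub
      ((Lp.memLp (div w)).locallyIntegrable Fact.out)
  have hz := hΩ.ae_eq_zero_of_integral_contDiff_smul_eq_zero (hli.locallyIntegrableOn Ω) (by
    intro φ h₁ h₂ h₃
    have hφ : IsTestFunction Ω φ := ⟨h₁, h₂, h₃⟩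
    have hv := isWeakDiv v φ hφ
    have hw := isWeakDiv w φ hφ
    rw [h] at hv
    have he : ∀ x, φ x • (div v x - div w x) = div v x * φ x - div w x * φ x := fun x => by
      rw [smul_eq_mul]; ring
    simp_rw [he]
    rw [integral_sub (hφ.integrable_div _) (hφ.integrable_div _)]
    linarith)
  have hd : div v = div w := by
    refine Lp.ext ?_
    filter_upwards [hz, ae_restrict_mem hΩ.measurableSet] with x hx hxΩ
    exact sub_eq_zero.1 (hx hxΩ)
  exact Subtype.ext ((WithLp.ofLp_injective 1) (Prod.ext h hd))

end WpDiv

/-- `C^∞(Ω̄)^3`: vector fields which on `Ω̄` agree with a smooth field defined on all of `ℝ³`. -/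
def SmoothUpToBoundary (Ω : Set E3) : Set (E3 → E3) :=
  {φ | ∃ ψ : E3 → E3, ContDiff ℝ ∞ ψ ∧ EqOn φ ψ (closure Ω)}

end

/-!
Regularity up to the boundary is gained by mollifying after a small translation. A smooth partition
of unity subordinate to a cover of `closure Ω` reduces the density to the pieces `χᵢ u`, which by
the Leibniz rule stay in `W^p(div; Ω)` and near whose support a fixed direction `v` points into `Ω`.
Convolve `χᵢ u`, extended by zero, with a kernel `K` concentrated near `-t v`. For `x ∈ Ω` the
function `y ↦ K (x - y)` then vanishes at the points of `supp χᵢ` outside `Ω`, so it may be used to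
test the weak divergence: on `Ω` the divergence of the convolution is the convolution of the weak
divergence, with no contribution from the jump across the boundary. As `K` shrinks to the origin,
Minkowski's inequality and the continuity of translations in `L^p` give the convergence of both.
-/

section Translation

open Filter Topology

theorem tendsto_eLpNorm_translate_sub {G F : Type*} [AddCommGroup G] [TopologicalSpace G]
    [IsTopologicalAddGroup G] [MeasurableSpace G] [BorelSpace G] [NormedAddCommGroup F]
    {μ : Measure G} [IsLocallyFiniteMeasure μ] [μ.InnerRegularCompactLTTop]
    [μ.IsAddLeftInvariant] {p : ℝ≥0∞} (hp_one : 1 ≤ p) (hp_top : p ≠ ⊤) {f : G → F}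
    (hf : MemLp f p μ) :
    Tendsto (fun z => eLpNorm (fun x => f (x - z) - f x) p μ) (𝓝 0) (𝓝 0) := by
  have : Fact (1 ≤ p) := ⟨hp_one⟩
  have : Fact (p ≠ ⊤) := ⟨hp_top⟩
  have translate_continuous : Continuous fun z : G => DomAddAct.mk (-z) +ᵥ hf.toLp f :=
    (DomAddAct.continuous_mk.comp continuous_neg).vadd continuous_const
  have edist_tendsto := (translate_continuous.tendsto 0).edist
    (tendsto_const_nhds (x := hf.toLp f))
  simp only [neg_zero, DomAddAct.mk_zero, zero_vadd, edist_self] at edist_tendsto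
  refine edist_tendsto.congr fun z => ?_
  rw [DomAddAct.mk_vadd_toLp, Lp.edist_toLp_toLp]
  refine eLpNorm_congr_ae (.of_forall fun x => ?_)
  simp [vadd_eq_add, sub_eq_neg_add]

end Translation

section Minkowski

variable {X Z F : Type*} [MeasurableSpace X] [MeasurableSpace Z] [NormedAddCommGroup F]
  [NormedSpace ℝ F] {μ : Measure X} {ν : Measure Z} [IsProbabilityMeasure ν] {p : ℝ≥0∞}

theorem enorm_integral_rpow_le_lintegral_enorm_rpow (hp_one : 1 ≤ p) (hp_top : p ≠ ⊤) {g : Z → F}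
    (hg : AEStronglyMeasurable g ν) :
    ‖∫ z, g z ∂ν‖ₑ ^ p.toReal ≤ ∫⁻ z, ‖g z‖ₑ ^ p.toReal ∂ν := by
  have hp_zero : p ≠ 0 := (zero_lt_one.trans_le hp_one).ne'
  calc ‖∫ z, g z ∂ν‖ₑ ^ p.toReal
      ≤ eLpNorm g 1 ν ^ p.toReal := by
        rw [eLpNorm_one_eq_lintegral_enorm]
        gcongr
        exact enorm_integral_le_lintegral_enorm g
    _ ≤ eLpNorm g p ν ^ p.toReal := by
        gcongr
        exact eLpNorm_le_eLpNorm_of_exponent_le hp_one hg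
    _ = ∫⁻ z, ‖g z‖ₑ ^ p.toReal ∂ν := by
        rw [eLpNorm_eq_lintegral_rpow_enorm_toReal hp_zero hp_top, one_div,
          ENNReal.rpow_inv_rpow (ENNReal.toReal_pos hp_zero hp_top).ne']

theorem eLpNorm_integral_le_of_ae_eLpNorm_le [SFinite μ] (hp_one : 1 ≤ p) (hp_top : p ≠ ⊤)
    {f : X → Z → F} (hf : AEStronglyMeasurable (Function.uncurry f) (μ.prod ν)) {C : ℝ≥0∞}
    (hC : ∀ᵐ z ∂ν, eLpNorm (fun x => f x z) p μ ≤ C) :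
    eLpNorm (fun x => ∫ z, f x z ∂ν) p μ ≤ C := by
  have hp_zero : p ≠ 0 := (zero_lt_one.trans_le hp_one).ne'
  have hp_pos : 0 < p.toReal := ENNReal.toReal_pos hp_zero hp_top
  simp only [eLpNorm_eq_lintegral_rpow_enorm_toReal hp_zero hp_top, one_div,
    ENNReal.rpow_inv_le_iff hp_pos] at hC ⊢
  calc ∫⁻ x, ‖∫ z, f x z ∂ν‖ₑ ^ p.toReal ∂μ
      ≤ ∫⁻ x, ∫⁻ z, ‖f x z‖ₑ ^ p.toReal ∂ν ∂μ :=
        lintegral_mono_ae <| hf.prodMk_left.mono fun _ =>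
          enorm_integral_rpow_le_lintegral_enorm_rpow hp_one hp_top
    _ = ∫⁻ z, ∫⁻ x, ‖f x z‖ₑ ^ p.toReal ∂μ ∂ν :=
        lintegral_lintegral_swap (hf.enorm.pow_const p.toReal)
    _ ≤ ∫⁻ _, C ^ p.toReal ∂ν := lintegral_mono_ae hC
    _ = C ^ p.toReal := by simp

end Minkowski

section Mollifier

open Filter Topology ContinuousLinearMap Function
open scoped Convolution

/-- A smooth, compactly supported probability density `K` with respect to `μ`. Its support may be
anywhere: mollifying by a density concentrated near `-v` also translates by `v`. -/
structure IsMollifier {E : Type*} [NormedAddCommGroup E] [NormedSpace ℝ E] [MeasurableSpace E]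
    (K : E → ℝ) (μ : Measure E) : Prop where
  contDiff : ContDiff ℝ ∞ K
  hasCompactSupport : HasCompactSupport K
  nonneg : ∀ x, 0 ≤ K x
  integral_eq_one : ∫ x, K x ∂μ = 1

variable {E F : Type*} [NormedAddCommGroup E] [NormedSpace ℝ E]
  [MeasurableSpace E] [BorelSpace E] [NormedAddCommGroup F] [NormedSpace ℝ F] {μ : Measure E}
  {K : E → ℝ}

namespace IsMollifier

section

variable [IsFiniteMeasureOnCompacts μ]

theorem integrable (hK : IsMollifier K μ) : Integrable K μ :=
  hK.contDiff.continuous.integrable_of_hasCompactSupport hK.hasCompactSupport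

theorem isProbabilityMeasure_withDensity (hK : IsMollifier K μ) :
    IsProbabilityMeasure (μ.withDensity fun z => ENNReal.ofReal (K z)) where
  measure_univ := by
    rw [withDensity_apply _ .univ, Measure.restrict_univ,
      ← ofReal_integral_eq_lintegral_ofReal hK.integrable (.of_forall hK.nonneg),
      hK.integral_eq_one, ENNReal.ofReal_one]

end

theorem integral_withDensity (hK : IsMollifier K μ) (g : E → F) :
    ∫ z, g z ∂(μ.withDensity fun z => ENNReal.ofReal (K z)) = ∫ z, K z • g z ∂μ := by
  rw [integral_withDensity_eq_integral_toReal_smul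
    hK.contDiff.continuous.measurable.ennreal_ofReal (.of_forall fun _ => ENNReal.ofReal_lt_top)]
  simp only [ENNReal.toReal_ofReal (hK.nonneg _)]

variable [FiniteDimensional ℝ E] [μ.IsAddHaarMeasure] [CompleteSpace F] {f : E → F} {p : ℝ≥0∞}

theorem convolution_sub_eq_integral (hK : IsMollifier K μ) (hf : LocallyIntegrable f μ) (x : E) :
    (K ⋆[lsmul ℝ ℝ, μ] f) x - f x =
      ∫ z, (f (x - z) - f x) ∂(μ.withDensity fun z => ENNReal.ofReal (K z)) := by
  have convolution_exists : Integrable (fun z => K z • f (x - z)) μ :=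
    hK.hasCompactSupport.convolutionExists_left (lsmul ℝ ℝ) hK.contDiff.continuous hf x
  simp only [hK.integral_withDensity, smul_sub]
  rw [integral_sub convolution_exists (hK.integrable.smul_const _), integral_smul_const,
    hK.integral_eq_one, one_smul]
  rfl

theorem eLpNorm_convolution_sub_le (hK : IsMollifier K μ) (hp_one : 1 ≤ p) (hp_top : p ≠ ⊤)
    (hf : MemLp f p μ) {C : ℝ≥0∞}
    (hC : ∀ z ∈ support K, eLpNorm (fun x => f (x - z) - f x) p μ ≤ C) :
    eLpNorm (fun x => (K ⋆[lsmul ℝ ℝ, μ] f) x - f x) p μ ≤ C := by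
  have := hK.isProbabilityMeasure_withDensity
  simp only [hK.convolution_sub_eq_integral (hf.locallyIntegrable hp_one)]
  refine eLpNorm_integral_le_of_ae_eLpNorm_le hp_one hp_top ?_ ?_
  · have measurable_translate : AEStronglyMeasurable (fun q : E × E => f (q.1 - q.2)) (μ.prod μ) :=
      hf.1.comp_quasiMeasurePreserving (quasiMeasurePreserving_sub μ μ)
    exact (measurable_translate.sub hf.1.comp_fst).mono_ac
      (Measure.AbsolutelyContinuous.rfl.prod (withDensity_absolutelyContinuous μ _))
  · rw [ae_withDensity_iff hK.contDiff.continuous.measurable.ennreal_ofReal]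
    refine .of_forall fun z hz => hC z fun hKz => hz ?_
    rw [hKz, ENNReal.ofReal_zero]

end IsMollifier

theorem exists_isMollifier_support_eq_ball [FiniteDimensional ℝ E] (μ : Measure E)
    [μ.IsAddHaarMeasure] (c : E) {ε : ℝ} (hε : 0 < ε) :
    ∃ K, IsMollifier K μ ∧ support K = Metric.ball c ε := by
  let b : ContDiffBump c := ⟨ε / 2, ε, half_pos hε, half_lt_self hε⟩
  exact ⟨b.normed μ, ⟨b.contDiff_normed, b.hasCompactSupport_normed, b.nonneg_normed,
    b.integral_normed⟩, b.support_normed_eq⟩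

variable [FiniteDimensional ℝ E] [μ.IsAddHaarMeasure] [CompleteSpace F] {f : E → F} {p : ℝ≥0∞}

theorem exists_nhds_eLpNorm_convolution_sub_le (hp_one : 1 ≤ p) (hp_top : p ≠ ⊤)
    (hf : MemLp f p μ) {ε : ℝ≥0∞} (hε : 0 < ε) :
    ∃ N ∈ 𝓝 (0 : E), ∀ K, IsMollifier K μ → support K ⊆ N →
      eLpNorm (fun x => (K ⋆[lsmul ℝ ℝ, μ] f) x - f x) p μ ≤ ε :=
  ⟨_, (tendsto_eLpNorm_translate_sub hp_one hp_top hf).eventually_le_const hε,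
    fun _ hK hKN => hK.eLpNorm_convolution_sub_le hp_one hp_top hf fun _ hz => hKN hz⟩

end Mollifier

section Divergence

open ContinuousLinearMap
open scoped Convolution

variable {E F : Type*} [NormedAddCommGroup E] [NormedSpace ℝ E] [NormedAddCommGroup F]
  [NormedSpace ℝ F]

theorem fderiv_comp_const_sub {f : E → F} {x y : E} (hf : DifferentiableAt ℝ f (x - y)) :
    fderiv ℝ (fun y => f (x - y)) y = -fderiv ℝ f (x - y) := by
  refine (hf.hasFDerivAt.comp y ((hasFDerivAt_id y).const_sub x)).fderiv.trans ?_
  ext v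
  simp

section

variable [MeasurableSpace E] [BorelSpace E] [FiniteDimensional ℝ E] {μ : Measure E}
  [μ.IsAddHaarMeasure]

theorem integral_fderiv_eq_zero {ψ : E → F} (hψ : ContDiff ℝ 1 ψ)
    (hψ_supp : HasCompactSupport ψ) :
    ∫ x, fderiv ℝ ψ x ∂μ = 0 := by
  have hψ' : Integrable (fderiv ℝ ψ) μ :=
    (hψ.continuous_fderiv one_ne_zero).integrable_of_hasCompactSupport (hψ_supp.fderiv ℝ)
  ext v
  have parts := integral_smul_fderiv_eq_neg_fderiv_smul_of_integrable (μ := μ) (v := v)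
    (f := fun _ => (1 : ℝ)) (g := ψ) (by simp) (by simpa using hψ'.apply_continuousLinearMap v)
    (by simpa using hψ.continuous.integrable_of_hasCompactSupport hψ_supp)
    (fun _ _ => by fun_prop) (fun x _ => hψ.differentiable one_ne_zero x)
  simpa [integral_apply hψ'] using parts

end

variable [FiniteDimensional ℝ E]

variable (E) in
/-- The trace as a continuous linear functional on the endomorphisms of a finite-dimensional
space. -/
noncomputable def traceCLM : (E →L[ℝ] E) →L[ℝ] ℝ :=
  LinearMap.toContinuousLinearMap (LinearMap.trace ℝ E ∘ₗ ContinuousLinearMap.coeLM ℝ)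

theorem traceCLM_smulRight (f : E →L[ℝ] ℝ) (v : E) : traceCLM E (f.smulRight v) = f v :=
  LinearMap.trace_smulRight f.toLinearMap v

/-- The classical divergence of a vector field, defined without coordinates as the trace of its
derivative. -/
noncomputable def divergence (ψ : E → E) (x : E) : ℝ :=
  traceCLM E (fderiv ℝ ψ x)

theorem continuous_divergence {ψ : E → E} (hψ : ContDiff ℝ 1 ψ) : Continuous (divergence ψ) :=
  (traceCLM E).continuous.comp (hψ.continuous_fderiv one_ne_zero)

theorem divergence_smul {φ : E → ℝ} {ψ : E → E} {x : E} (hφ : DifferentiableAt ℝ φ x)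
    (hψ : DifferentiableAt ℝ ψ x) :
    divergence (fun x => φ x • ψ x) x = φ x * divergence ψ x + fderiv ℝ φ x (ψ x) := by
  rw [divergence, fderiv_fun_smul hφ hψ, map_add, map_smul, traceCLM_smulRight, smul_eq_mul,
    divergence]

variable [MeasurableSpace E] [BorelSpace E] {μ : Measure E} [μ.IsAddHaarMeasure]

theorem integral_divergence_eq_zero {ψ : E → E} (hψ : ContDiff ℝ 1 ψ)
    (hψ_supp : HasCompactSupport ψ) :
    ∫ x, divergence ψ x ∂μ = 0 := by
  have hψ' : Integrable (fderiv ℝ ψ) μ :=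
    (hψ.continuous_fderiv one_ne_zero).integrable_of_hasCompactSupport (hψ_supp.fderiv ℝ)
  simp only [divergence]
  rw [(traceCLM E).integral_comp_comm hψ', integral_fderiv_eq_zero hψ hψ_supp, map_zero]

theorem divergence_convolution {K : E → ℝ} (hK : ContDiff ℝ 1 K) (hK_supp : HasCompactSupport K)
    {f : E → E} (hf : LocallyIntegrable f μ) (x : E) :
    divergence (K ⋆[lsmul ℝ ℝ, μ] f) x = ∫ y, fderiv ℝ K (x - y) (f y) ∂μ := by
  have convolution_exists :
      Integrable (fun z => (lsmul ℝ ℝ).precompL E (fderiv ℝ K z) (f (x - z))) μ :=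
    (hK_supp.fderiv ℝ).convolutionExists_left _ (hK.continuous_fderiv one_ne_zero) hf x
  calc divergence (K ⋆[lsmul ℝ ℝ, μ] f) x
      = ∫ z, traceCLM E ((lsmul ℝ ℝ).precompL E (fderiv ℝ K z) (f (x - z))) ∂μ := by
        rw [divergence, (hK_supp.hasFDerivAt_convolution_left (lsmul ℝ ℝ) hK hf x).fderiv,
          convolution, ← (traceCLM E).integral_comp_comm convolution_exists]
    _ = ∫ z, fderiv ℝ K z (f (x - z)) ∂μ := by
        refine integral_congr_ae (.of_forall fun z => ?_)
        exact traceCLM_smulRight (fderiv ℝ K z) (f (x - z))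
    _ = ∫ y, fderiv ℝ K (x - y) (f y) ∂μ := by
        rw [← integral_sub_left_eq_self (fun y => fderiv ℝ K (x - y) (f y)) μ x]
        simp only [sub_sub_cancel]

end Divergence

section Integrability

open ContinuousLinearMap

variable {X F G H : Type*} [MeasurableSpace X] [NormedAddCommGroup F] [NormedSpace ℝ F]
  [NormedAddCommGroup G] [NormedSpace ℝ G] [NormedAddCommGroup H] [NormedSpace ℝ H] {μ : Measure X}

theorem integral_apply_indicator {s : Set X} (hs : MeasurableSet s) (A : X → F →L[ℝ] G)
    (u : X → F) :
    ∫ x, A x (s.indicator u x) ∂μ = ∫ x in s, A x (u x) ∂μ := by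
  rw [← integral_indicator hs]
  congr 1 with x
  by_cases hx : x ∈ s <;> simp [hx]

theorem integrable_bilin_of_hasCompactSupport [TopologicalSpace X] [OpensMeasurableSpace X]
    (L : F →L[ℝ] G →L[ℝ] H) {a : X → F} {u : X → G} (ha : Continuous a)
    (ha_supp : HasCompactSupport a) (hu : LocallyIntegrable u μ) :
    Integrable (fun x => L (a x) (u x)) μ := by
  refine (integrableOn_iff_integrable_of_support_subset (s := tsupport a) ?_).1 ?_
  · refine Function.support_subset_iff'.2 fun x hx => ?_
    rw [image_eq_zero_of_notMem_tsupport hx, map_zero, zero_apply]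
  · exact memLp_one_iff_integrable.1 <| L.memLp_of_bilin 1
      (ha.memLp_top_of_hasCompactSupport ha_supp _)
      (memLp_one_iff_integrable.2 (hu.integrableOn_isCompact ha_supp))

theorem memLp_smul_of_hasCompactSupport [TopologicalSpace X] [OpensMeasurableSpace X] {p : ℝ≥0∞}
    {χ : X → ℝ} {u : X → F} (hχ : Continuous χ) (hχ_supp : HasCompactSupport χ)
    (hu : MemLp u p μ) : MemLp (fun x => χ x • u x) p μ :=
  (lsmul ℝ ℝ).memLp_of_bilin p (hχ.memLp_top_of_hasCompactSupport hχ_supp μ) hu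

end Integrability

section LeibnizRule

variable {E : Type*} [NormedAddCommGroup E] [NormedSpace ℝ E]

/-- The divergence of `χ • u` predicted by the Leibniz rule when `u` has divergence `d`. -/
noncomputable def leibnizDiv (χ : E → ℝ) (u : E → E) (d : E → ℝ) (x : E) : ℝ :=
  χ x * d x + fderiv ℝ χ x (u x)

theorem memLp_leibnizDiv [MeasurableSpace E] [OpensMeasurableSpace E] {μ : Measure E}
    {p : ℝ≥0∞} {χ : E → ℝ} {u : E → E} {d : E → ℝ} (hχ : ContDiff ℝ 1 χ)
    (hχ_supp : HasCompactSupport χ) (hu : MemLp u p μ) (hd : MemLp d p μ) :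
    MemLp (leibnizDiv χ u d) p μ :=
  (memLp_smul_of_hasCompactSupport hχ.continuous hχ_supp hd).add
    ((ContinuousLinearMap.id ℝ (E →L[ℝ] ℝ)).memLp_of_bilin p
      ((hχ.continuous_fderiv one_ne_zero).memLp_top_of_hasCompactSupport (hχ_supp.fderiv ℝ) μ) hu)

end LeibnizRule

section WeakDivergence

open ContinuousLinearMap
open scoped Convolution

variable {Ω : Set E3} {u : E3 → E3} {d : E3 → ℝ} {χ : E3 → ℝ}

theorem isWeakDiv_iff_fderiv : IsWeakDiv Ω u d ↔
    ∀ φ, IsTestFunction Ω φ → ∫ x in Ω, fderiv ℝ φ x (u x) = -∫ x in Ω, d x * φ x := by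
  simp only [IsWeakDiv, inner_gradient_right, conj_trivial]

theorem IsWeakDiv.congr {u' : E3 → E3} {d' : E3 → ℝ} (h : IsWeakDiv Ω u d)
    (hu : u =ᵐ[volume.restrict Ω] u') (hd : d =ᵐ[volume.restrict Ω] d') :
    IsWeakDiv Ω u' d' := by
  intro φ hφ
  calc ∫ x in Ω, inner ℝ (u' x) (gradient φ x)
      = ∫ x in Ω, inner ℝ (u x) (gradient φ x) :=
        integral_congr_ae (hu.mono fun x hx => by simp only [hx])
    _ = -∫ x in Ω, d x * φ x := h φ hφ
    _ = -∫ x in Ω, d' x * φ x :=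
        congrArg Neg.neg (integral_congr_ae (hd.mono fun x hx => by simp only [hx]))

theorem isWeakDiv_divergence {ψ : E3 → E3} (hψ : ContDiff ℝ 1 ψ) :
    IsWeakDiv Ω ψ (divergence ψ) := by
  refine isWeakDiv_iff_fderiv.2 fun φ ⟨hφ, hφ_supp, hφΩ⟩ => ?_
  have hφ_one : ContDiff ℝ 1 φ := hφ.of_le (by simp)
  have ψ_integrable : LocallyIntegrable ψ (volume.restrict Ω) := hψ.continuous.locallyIntegrable
  have divergence_eq_zero : ∀ x ∉ Ω, divergence (fun x => φ x • ψ x) x = 0 := fun x hx => by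
    rw [divergence, fderiv_of_notMem_tsupport ℝ fun h => hx (hφΩ (tsupport_smul_subset_left φ ψ h)),
      map_zero]
  have gauss : ∫ x in Ω, divergence (fun x => φ x • ψ x) x = 0 := by
    rw [setIntegral_eq_integral_of_forall_compl_eq_zero divergence_eq_zero]
    exact integral_divergence_eq_zero (ψ := φ • ψ) (hφ_one.smul hψ) hφ_supp.smul_right
  have leibniz : ∀ x, divergence (fun x => φ x • ψ x) x =
      divergence ψ x * φ x + fderiv ℝ φ x (ψ x) := fun x => by
    rw [divergence_smul (hφ_one.differentiable one_ne_zero x) (hψ.differentiable one_ne_zero x),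
      mul_comm]
  simp only [leibniz] at gauss
  rw [integral_add] at gauss
  · linarith
  · exact ((continuous_divergence hψ).mul hφ.continuous).integrable_of_hasCompactSupport
      hφ_supp.mul_left
  · exact integrable_bilin_of_hasCompactSupport (.id ℝ _) (hφ_one.continuous_fderiv one_ne_zero)
      (hφ_supp.fderiv ℝ) ψ_integrable

namespace IsWeakDiv

theorem setIntegral_fderiv_smul (h : IsWeakDiv Ω u d)
    (hu : LocallyIntegrable u (volume.restrict Ω)) (hd : LocallyIntegrable d (volume.restrict Ω))
    (hχ : ContDiff ℝ ∞ χ) (hχ_supp : HasCompactSupport χ) {φ : E3 → ℝ} (hφ : ContDiff ℝ ∞ φ)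
    (hχφ : tsupport χ ∩ tsupport φ ⊆ Ω) :
    ∫ x in Ω, fderiv ℝ φ x (χ x • u x) = -∫ x in Ω, leibnizDiv χ u d x * φ x := by
  have hχ' := hχ.continuous_fderiv (by simp)
  have hφ' := hφ.continuous_fderiv (by simp)
  have test : IsTestFunction Ω (χ * φ) := ⟨hχ.mul hφ, hχ_supp.mul_right, fun x hx =>
    hχφ ⟨tsupport_mul_subset_left hx, tsupport_mul_subset_right hx⟩⟩
  have fderiv_integrable : Integrable (fun x => fderiv ℝ φ x (χ x • u x)) (volume.restrict Ω) := by
    simp only [map_smul]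
    exact integrable_bilin_of_hasCompactSupport (.id ℝ _) (hχ.continuous.smul hφ')
      hχ_supp.smul_right hu
  have cutoff_integrable : Integrable (fun x => φ x * fderiv ℝ χ x (u x)) (volume.restrict Ω) :=
    integrable_bilin_of_hasCompactSupport (.id ℝ _) (hφ.continuous.smul hχ')
      (hχ_supp.fderiv ℝ).smul_left hu
  have div_integrable : Integrable (fun x => (χ x * φ x) * d x) (volume.restrict Ω) :=
    integrable_bilin_of_hasCompactSupport (lsmul ℝ ℝ) test.1.continuous test.2.1 hd
  have tested := isWeakDiv_iff_fderiv.1 h _ test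
  have product_rule : ∀ x, fderiv ℝ (χ * φ) x (u x) =
      fderiv ℝ φ x (χ x • u x) + φ x * fderiv ℝ χ x (u x) := fun x => by
    rw [fderiv_mul (hχ.differentiable (by simp) x) (hφ.differentiable (by simp) x)]
    simp
  have leibniz_mul : ∀ x, leibnizDiv χ u d x * φ x =
      χ x * φ x * d x + φ x * fderiv ℝ χ x (u x) := fun x => by rw [leibnizDiv]; ring
  simp only [product_rule, Pi.mul_apply, mul_comm (d _)] at tested
  simp only [leibniz_mul]
  rw [integral_add fderiv_integrable cutoff_integrable] at tested
  rw [integral_add div_integrable cutoff_integrable]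
  linarith

theorem smul (h : IsWeakDiv Ω u d)
    (hu : LocallyIntegrable u (volume.restrict Ω)) (hd : LocallyIntegrable d (volume.restrict Ω))
    (hχ : ContDiff ℝ ∞ χ) (hχ_supp : HasCompactSupport χ) :
    IsWeakDiv Ω (fun x => χ x • u x) (leibnizDiv χ u d) :=
  isWeakDiv_iff_fderiv.2 fun _ ⟨hφ, _, hφΩ⟩ =>
    h.setIntegral_fderiv_smul hu hd hχ hχ_supp hφ (inter_subset_right.trans hφΩ)

theorem divergence_convolution_indicator (h : IsWeakDiv Ω u d) (hΩ : MeasurableSet Ω)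
    (hu : LocallyIntegrable u (volume.restrict Ω)) (hd : LocallyIntegrable d (volume.restrict Ω))
    (hχ : ContDiff ℝ ∞ χ) (hχ_supp : HasCompactSupport χ) {K : E3 → ℝ} (hK : ContDiff ℝ ∞ K)
    (hK_supp : HasCompactSupport K) {x : E3}
    (hx : ∀ y ∈ tsupport χ, x - y ∈ tsupport K → y ∈ Ω) :
    divergence (K ⋆[lsmul ℝ ℝ] Ω.indicator fun y => χ y • u y) x =
      (K ⋆[lsmul ℝ ℝ] Ω.indicator (leibnizDiv χ u d)) x := by
  have cutoff_integrable : LocallyIntegrable (Ω.indicator fun y => χ y • u y) :=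
    ((integrable_indicator_iff hΩ).2 <| integrable_bilin_of_hasCompactSupport (lsmul ℝ ℝ)
      hχ.continuous hχ_supp hu).locallyIntegrable
  have tsupport_kernel : tsupport (fun y => K (x - y)) ⊆ (x - ·) ⁻¹' tsupport K :=
    tsupport_comp_subset_preimage K (by fun_prop)
  have fderiv_kernel : ∀ y, fderiv ℝ (fun y => K (x - y)) y = -fderiv ℝ K (x - y) := fun y =>
    fderiv_comp_const_sub (hK.differentiable (by simp) (x - y))
  have tested := h.setIntegral_fderiv_smul hu hd hχ hχ_supp (φ := fun y => K (x - y))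
    (hK.comp (contDiff_const.sub contDiff_id)) fun y hy => hx y hy.1 (tsupport_kernel hy.2)
  simp only [fderiv_kernel, neg_apply, integral_neg, neg_inj] at tested
  calc divergence (K ⋆[lsmul ℝ ℝ] Ω.indicator fun y => χ y • u y) x
      = ∫ y, fderiv ℝ K (x - y) (Ω.indicator (fun y => χ y • u y) y) :=
        divergence_convolution (hK.of_le (by simp)) hK_supp cutoff_integrable x
    _ = ∫ y in Ω, fderiv ℝ K (x - y) (χ y • u y) :=
        integral_apply_indicator hΩ _ _
    _ = ∫ y in Ω, leibnizDiv χ u d y * K (x - y) := tested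
    _ = (K ⋆[lsmul ℝ ℝ] Ω.indicator (leibnizDiv χ u d)) x := by
        rw [convolution_eq_swap, integral_apply_indicator hΩ]
        simp only [lsmul_apply, smul_eq_mul, mul_comm]

end IsWeakDiv

end WeakDivergence

section Segment

open Filter Topology Function Metric

variable {E : Type*} [NormedAddCommGroup E] [NormedSpace ℝ E] {Ω U : Set E} {v : E}

/-- Inside `U`, the open segment from any point of `closure Ω` in direction `v` stays in `Ω`. -/
def IsInwardOn (Ω U : Set E) (v : E) : Prop :=
  ∀ x ∈ closure Ω ∩ U, ∀ t ∈ Ioo (0 : ℝ) 1, x + t • v ∈ Ω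

/-- Adams' segment property: near every boundary point some fixed direction points into `Ω`. -/
def SegmentProperty (Ω : Set E) : Prop :=
  ∀ x₀ ∈ frontier Ω, ∃ U, IsOpen U ∧ x₀ ∈ U ∧ ∃ v, IsInwardOn Ω U v

theorem SegmentProperty.exists_isInwardOn (hS : SegmentProperty Ω) (hΩ : IsOpen Ω) {x₀ : E}
    (hx₀ : x₀ ∈ closure Ω) : ∃ U, IsOpen U ∧ x₀ ∈ U ∧ ∃ v, IsInwardOn Ω U v := by
  rw [closure_eq_self_union_frontier] at hx₀
  obtain hx₀ | hx₀ := hx₀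
  · exact ⟨Ω, hΩ, hx₀, 0, fun x hx t _ => by simpa using hx.2⟩
  · exact hS x₀ hx₀

variable [FiniteDimensional ℝ E] [MeasurableSpace E] [BorelSpace E] {μ : Measure E}
  [μ.IsAddHaarMeasure]

theorem IsInwardOn.exists_isMollifier (hv : IsInwardOn Ω U v) (hΩ : IsOpen Ω) (hU : IsOpen U)
    {S : Set E} (hS : IsCompact S) (hSU : S ⊆ U) {N : Set E} (hN : N ∈ 𝓝 0) :
    ∃ K, IsMollifier K μ ∧ support K ⊆ N ∧ ∀ x ∈ Ω, ∀ y ∈ S, x - y ∈ tsupport K → y ∈ Ω := by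
  obtain ⟨r, hr, hrU⟩ := hS.exists_cthickening_subset_open hU hSU
  have interior_mem : interior (N ∩ ball 0 r) ∈ 𝓝 (0 : E) :=
    interior_mem_nhds.2 (inter_mem hN (ball_mem_nhds 0 hr))
  obtain ⟨t, ht, htN⟩ : ∃ t ∈ Ioo (0 : ℝ) 1, -(t • v) ∈ interior (N ∩ ball 0 r) := by
    have translate_tendsto : Tendsto (fun t : ℝ => -(t • v)) (𝓝[>] 0) (𝓝 0) :=
      (Continuous.tendsto' (by fun_prop) 0 0 (by simp)).mono_left nhdsWithin_le_nhds
    have small : ∀ᶠ t in 𝓝[>] (0 : ℝ), t ∈ Ioo (0 : ℝ) 1 := Ioo_mem_nhdsGT one_pos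
    exact (small.and (translate_tendsto interior_mem)).exists
  obtain ⟨ρ, hρ, hρN⟩ := Metric.isOpen_iff.1 isOpen_interior _ htN
  have translate_compact : IsCompact ((· + t • v) '' (closure Ω ∩ cthickening r S)) :=
    (hS.cthickening.inter_left isClosed_closure).image (continuous_add_const (t • v))
  have translate_subset : (· + t • v) '' (closure Ω ∩ cthickening r S) ⊆ Ω :=
    image_subset_iff.2 fun x hx => hv x ⟨hx.1, hrU hx.2⟩ t ht
  obtain ⟨η, hη, hηΩ⟩ := translate_compact.exists_cthickening_subset_open hΩ translate_subset
  obtain ⟨K, hK, hK_supp⟩ := exists_isMollifier_support_eq_ball μ (-(t • v)) (lt_min hρ hη)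
  have hKN : support K ⊆ N ∩ ball 0 r := by
    rw [hK_supp]
    exact (ball_subset_ball (min_le_left _ _)).trans (hρN.trans interior_subset)
  refine ⟨K, hK, hKN.trans inter_subset_left, fun x hx y hy hxy => ?_⟩
  have near_S : ‖x - y‖ ≤ r := by
    simpa using closure_ball_subset_closedBall (closure_mono (hKN.trans inter_subset_right) hxy)
  have near_translate : ‖x - y + t • v‖ ≤ η := by
    rw [tsupport, hK_supp] at hxy
    have := closure_ball_subset_closedBall hxy
    rw [mem_closedBall_iff_norm, sub_neg_eq_add] at this
    exact this.trans (min_le_right _ _)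
  refine hηΩ (mem_cthickening_of_dist_le y (x + t • v) η _ ⟨x, ⟨subset_closure hx,
    mem_cthickening_of_dist_le x y r S hy (by rwa [dist_eq_norm])⟩, rfl⟩ ?_)
  rwa [dist_comm, dist_eq_norm, add_sub_right_comm]

end Segment

section PartitionOfUnity

open Metric

variable {E : Type*} [NormedAddCommGroup E] [NormedSpace ℝ E] [FiniteDimensional ℝ E]

theorem exists_contDiff_partition_of_isCompact {s : Set E} (hs : IsCompact s) {U : E → Set E}
    (hU : ∀ x ∈ s, IsOpen (U x)) (hxU : ∀ x ∈ s, x ∈ U x) :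
    ∃ t : Finset E, ↑t ⊆ s ∧ ∃ χ : t → E → ℝ, (∀ i, ContDiff ℝ ∞ (χ i)) ∧
      (∀ i, HasCompactSupport (χ i)) ∧ (∀ i, tsupport (χ i) ⊆ U i) ∧ ∀ x ∈ s, ∑ i, χ i x = 1 := by
  obtain ⟨t, hts, hst⟩ := hs.elim_nhds_subcover (fun x => U x ∩ ball x 1) fun x hx =>
    ((hU x hx).inter isOpen_ball).mem_nhds ⟨hxU x hx, mem_ball_self one_pos⟩
  obtain ⟨χ, hχ⟩ := SmoothPartitionOfUnity.exists_isSubordinate (modelWithCornersSelf ℝ E)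
    hs.isClosed (fun i : t => U i ∩ ball i.1 1) (fun i => (hU i (hts i i.2)).inter isOpen_ball)
    (by rwa [iUnion_subtype])
  refine ⟨t, hts, fun i => χ i, fun i => (χ i).contMDiff.contDiff, fun i => ?_,
    fun i => (hχ i).trans inter_subset_left, fun x hx => ?_⟩
  · refine .of_support_subset_isCompact (isCompact_closedBall i.1 1) ?_
    exact (subset_tsupport _).trans ((hχ i).trans (inter_subset_right.trans
      ball_subset_closedBall))
  · rw [← finsum_eq_sum_of_fintype]
    exact χ.sum_eq_one hx

end PartitionOfUnity

section LipschitzBoundary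

open Metric

theorem horiz_add_smul_single_two (y : E3) (t s : ℝ) :
    horiz (y + t • EuclideanSpace.single 2 s) = horiz y := by
  ext i
  fin_cases i <;> simp [horiz]

theorem HasLipschitzBoundary.segmentProperty {Ω : Set E3} (hL : HasLipschitzBoundary Ω) :
    SegmentProperty Ω := by
  intro x₀ hx₀
  obtain ⟨V, hV, hx₀V, e, K, g, -, hΩV, hfV⟩ := hL x₀ hx₀
  obtain ⟨r, hr, hrV⟩ := Metric.isOpen_iff.1 hV x₀ hx₀V
  let v : E3 := e.symm (EuclideanSpace.single 2 (r / 2))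
  have norm_v : ‖v‖ = r / 2 := by simp [v, abs_of_pos hr]
  refine ⟨ball x₀ (r / 2), isOpen_ball, mem_ball_self (half_pos hr), v, ?_⟩
  rintro x ⟨hx, hx_ball⟩ t ⟨ht_pos, ht_one⟩
  have hxV : x ∈ V := hrV (ball_subset_ball (half_le_self hr.le) hx_ball)
  have translate_mem : x + t • v ∈ V := by
    refine hrV ?_
    rw [mem_ball_iff_norm] at hx_ball ⊢
    calc ‖x + t • v - x₀‖ = ‖(x - x₀) + t • v‖ := by rw [add_sub_right_comm]
      _ ≤ ‖x - x₀‖ + ‖t • v‖ := norm_add_le _ _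
      _ = ‖x - x₀‖ + t * (r / 2) := by rw [norm_smul_of_nonneg ht_pos.le, norm_v]
      _ < r := by nlinarith
  have above_graph : g (horiz (e x)) ≤ e x 2 := by
    rw [closure_eq_self_union_frontier] at hx
    rcases hx with hx | hx
    · exact (hΩV.subset ⟨hx, hxV⟩).1.le
    · exact (hfV.subset ⟨hx, hxV⟩).1.le
  have e_translate : e (x + t • v) = e x + t • EuclideanSpace.single 2 (r / 2) := by simp [v]
  refine (hΩV.superset ⟨?_, translate_mem⟩).1
  calc g (horiz (e (x + t • v))) = g (horiz (e x)) := by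
        rw [e_translate, horiz_add_smul_single_two]
    _ ≤ e x 2 := above_graph
    _ < e x 2 + t * (r / 2) := lt_add_of_pos_right _ (mul_pos ht_pos (half_pos hr))
    _ = e (x + t • v) 2 := by simp [e_translate]

end LipschitzBoundary

section Localisation

open ContinuousLinearMap
open scoped Convolution

theorem memLp_restrict_of_isBounded {X F : Type*} [PseudoMetricSpace X] [ProperSpace X]
    [MeasurableSpace X] [OpensMeasurableSpace X] [NormedAddCommGroup F] {μ : Measure X}
    [IsFiniteMeasureOnCompacts μ] {s : Set X} (hs : Bornology.IsBounded s) {f : X → F}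
    (hf : Continuous f) {p : ℝ≥0∞} : MemLp f p (μ.restrict s) := by
  have : IsFiniteMeasure (μ.restrict (closure s)) := ⟨by simpa using hs.closure.measure_lt_top⟩
  obtain ⟨C, hC⟩ := hs.isCompact_closure.exists_bound_of_continuousOn hf.continuousOn
  have memLp_closure : MemLp f p (μ.restrict (closure s)) :=
    .of_bound hf.aestronglyMeasurable C ((ae_restrict_mem measurableSet_closure).mono hC)
  exact memLp_closure.mono_measure (Measure.restrict_mono_set μ subset_closure)

theorem eLpNorm_sub_restrict_le {X F : Type*} [MeasurableSpace X] [NormedAddCommGroup F]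
    {μ : Measure X} {s : Set X} (hs : MeasurableSet s) {f g g' : X → F} (hg : EqOn g g' s)
    {p : ℝ≥0∞} :
    eLpNorm (g - f) p (μ.restrict s) ≤ eLpNorm (fun x => g' x - s.indicator f x) p μ := by
  refine (eLpNorm_congr_ae ?_).trans_le (eLpNorm_mono_measure _ Measure.restrict_le_self)
  filter_upwards [ae_restrict_mem hs] with x hx
  rw [Pi.sub_apply, hg hx, indicator_of_mem hx]

variable {Ω : Set E3} {u : E3 → E3} {d : E3 → ℝ} {χ : E3 → ℝ} {p : ℝ≥0∞}

theorem IsWeakDiv.exists_contDiff_eLpNorm_sub_le (h : IsWeakDiv Ω u d) (hp_one : 1 ≤ p)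
    (hp_top : p ≠ ⊤) (hu : MemLp u p (volume.restrict Ω)) (hd : MemLp d p (volume.restrict Ω))
    (hχ : ContDiff ℝ ∞ χ) (hχ_supp : HasCompactSupport χ) (hΩ : IsOpen Ω) {U : Set E3}
    (hU : IsOpen U) (hχU : tsupport χ ⊆ U) {v : E3} (hv : IsInwardOn Ω U v) {ε : ℝ≥0∞}
    (hε : 0 < ε) :
    ∃ ψ, ContDiff ℝ ∞ ψ ∧ eLpNorm (ψ - fun x => χ x • u x) p (volume.restrict Ω) ≤ ε ∧
      eLpNorm (divergence ψ - leibnizDiv χ u d) p (volume.restrict Ω) ≤ ε := by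
  have hΩ_meas := hΩ.measurableSet
  have field_memLp : MemLp (Ω.indicator fun x => χ x • u x) p :=
    (memLp_indicator_iff_restrict hΩ_meas).2
      (memLp_smul_of_hasCompactSupport hχ.continuous hχ_supp hu)
  have div_memLp : MemLp (Ω.indicator (leibnizDiv χ u d)) p :=
    (memLp_indicator_iff_restrict hΩ_meas).2 (memLp_leibnizDiv (hχ.of_le (by simp)) hχ_supp hu hd)
  obtain ⟨N₁, hN₁, field_close⟩ :=
    exists_nhds_eLpNorm_convolution_sub_le hp_one hp_top field_memLp hε
  obtain ⟨N₂, hN₂, div_close⟩ :=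
    exists_nhds_eLpNorm_convolution_sub_le hp_one hp_top div_memLp hε
  obtain ⟨K, hK, hKN, inward⟩ :=
    hv.exists_isMollifier (μ := volume) hΩ hU hχ_supp hχU (Filter.inter_mem hN₁ hN₂)
  refine ⟨K ⋆[lsmul ℝ ℝ] Ω.indicator fun x => χ x • u x,
    hK.hasCompactSupport.contDiff_convolution_left _ hK.contDiff
      (field_memLp.locallyIntegrable hp_one), ?_, ?_⟩
  · exact (eLpNorm_sub_restrict_le hΩ_meas fun _ _ => rfl).trans
      (field_close K hK (hKN.trans inter_subset_left))
  · have divergence_eq : EqOn (divergence (K ⋆[lsmul ℝ ℝ] Ω.indicator fun x => χ x • u x))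
        (K ⋆[lsmul ℝ ℝ] Ω.indicator (leibnizDiv χ u d)) Ω := fun x hx =>
      h.divergence_convolution_indicator hΩ_meas (hu.locallyIntegrable hp_one)
        (hd.locallyIntegrable hp_one) hχ hχ_supp hK.contDiff hK.hasCompactSupport (inward x hx)
    exact (eLpNorm_sub_restrict_le hΩ_meas divergence_eq).trans
      (div_close K hK (hKN.trans inter_subset_right))

end Localisation

namespace WpDiv

variable {p : ℝ≥0∞} [Fact (1 ≤ p)] {Ω : Set E3} {u u' : E3 → E3} {d d' : E3 → ℝ}
  {χ : E3 → ℝ} {U : Set E3} {v : E3}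

/-- The element of `W^p(div; Ω)` with given representatives of the field and its divergence. -/
noncomputable def ofMemLp (hu : MemLp u p (volume.restrict Ω))
    (hd : MemLp d p (volume.restrict Ω)) (h : IsWeakDiv Ω u d) : WpDiv p Ω :=
  ⟨WithLp.toLp 1 (hu.toLp u, hd.toLp d), h.congr hu.coeFn_toLp.symm hd.coeFn_toLp.symm⟩

theorem coeFn_field_ofMemLp (hu : MemLp u p (volume.restrict Ω))
    (hd : MemLp d p (volume.restrict Ω)) (h : IsWeakDiv Ω u d) :
    field (ofMemLp hu hd h) =ᵐ[volume.restrict Ω] u :=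
  hu.coeFn_toLp

/-- A `C¹` field on a bounded set, as an element of `W^p(div; Ω)`. -/
noncomputable def ofContDiff (hb : Bornology.IsBounded Ω) (hu : ContDiff ℝ 1 u) : WpDiv p Ω :=
  ofMemLp (memLp_restrict_of_isBounded hb hu.continuous)
    (memLp_restrict_of_isBounded hb (continuous_divergence hu)) (isWeakDiv_divergence hu)

theorem coeFn_field_ofContDiff (hb : Bornology.IsBounded Ω) (hu : ContDiff ℝ 1 u) :
    field (ofContDiff (p := p) hb hu) =ᵐ[volume.restrict Ω] u :=
  coeFn_field_ofMemLp _ _ _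

theorem edist_ofMemLp (hu : MemLp u p (volume.restrict Ω)) (hd : MemLp d p (volume.restrict Ω))
    (h : IsWeakDiv Ω u d) (hu' : MemLp u' p (volume.restrict Ω))
    (hd' : MemLp d' p (volume.restrict Ω)) (h' : IsWeakDiv Ω u' d') :
    edist (ofMemLp hu hd h) (ofMemLp hu' hd' h') =
      eLpNorm (u - u') p (volume.restrict Ω) + eLpNorm (d - d') p (volume.restrict Ω) := by
  rw [← Lp.edist_toLp_toLp u u' hu hu', ← Lp.edist_toLp_toLp d d' hd hd']
  exact WithLp.prod_edist_eq_of_L1 _ _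

theorem field_sum {ι : Type*} (s : Finset ι) (w : ι → WpDiv p Ω) :
    field (∑ i ∈ s, w i) = ∑ i ∈ s, field (w i) :=
  map_sum (AddMonoidHom.mk' (field : WpDiv p Ω → LpField p Ω) fun _ _ => rfl) w s

variable (p Ω) in
/-- The classes in `W^p(div; Ω)` of the fields in `C^∞(Ω̄)^3`. -/
def smoothFields : Submodule ℝ (WpDiv p Ω) where
  carrier := {w | ∃ φ ∈ SmoothUpToBoundary Ω, field w =ᵐ[volume.restrict Ω] φ}
  zero_mem' := ⟨0, ⟨0, contDiff_const, fun _ _ => rfl⟩, Lp.coeFn_zero _ _ _⟩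
  add_mem' := by
    rintro v w ⟨φ, ⟨φ', hφ', hφ⟩, hv⟩ ⟨ψ, ⟨ψ', hψ', hψ⟩, hw⟩
    exact ⟨φ + ψ, ⟨φ' + ψ', hφ'.add hψ', fun x hx => congrArg₂ (· + ·) (hφ hx) (hψ hx)⟩,
      (Lp.coeFn_add _ _).trans (hv.add hw)⟩
  smul_mem' := by
    rintro c w ⟨φ, ⟨φ', hφ', hφ⟩, hw⟩
    exact ⟨c • φ, ⟨c • φ', hφ'.const_smul c, fun x hx => congrArg (c • ·) (hφ hx)⟩,
      (Lp.coeFn_smul _ _).trans (hw.const_smul c)⟩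

/-- The product `χ u ∈ W^p(div; Ω)` of a cut-off function with `u ∈ W^p(div; Ω)`. -/
noncomputable def cutoff (hχ : ContDiff ℝ ∞ χ) (hχ_supp : HasCompactSupport χ)
    (w : WpDiv p Ω) : WpDiv p Ω :=
  ofMemLp (memLp_smul_of_hasCompactSupport hχ.continuous hχ_supp (Lp.memLp (field w)))
    (memLp_leibnizDiv (hχ.of_le (by simp)) hχ_supp (Lp.memLp (field w)) (Lp.memLp (div w)))
    ((isWeakDiv w).smul ((Lp.memLp (field w)).locallyIntegrable Fact.out)
      ((Lp.memLp (div w)).locallyIntegrable Fact.out) hχ hχ_supp)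

theorem coeFn_field_cutoff (hχ : ContDiff ℝ ∞ χ) (hχ_supp : HasCompactSupport χ)
    (w : WpDiv p Ω) :
    field (cutoff hχ hχ_supp w) =ᵐ[volume.restrict Ω] fun x => χ x • field w x :=
  coeFn_field_ofMemLp _ _ _

theorem ofContDiff_mem_smoothFields (hb : Bornology.IsBounded Ω) (hu : ContDiff ℝ ∞ u) :
    ofContDiff hb (hu.of_le (by simp)) ∈ smoothFields p Ω :=
  ⟨u, ⟨u, hu, fun _ _ => rfl⟩, coeFn_field_ofContDiff hb _⟩

theorem exists_contDiff_edist_cutoff_lt (hp_top : p ≠ ⊤) (hΩ : IsOpen Ω)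
    (hb : Bornology.IsBounded Ω) (hχ : ContDiff ℝ ∞ χ) (hχ_supp : HasCompactSupport χ)
    (hU : IsOpen U) (hχU : tsupport χ ⊆ U) (hv : IsInwardOn Ω U v) (w : WpDiv p Ω) {ε : ℝ≥0∞}
    (hε : 0 < ε) :
    ∃ (ψ : E3 → E3) (hψ : ContDiff ℝ ∞ ψ),
      edist (cutoff hχ hχ_supp w) (ofContDiff hb (hψ.of_le (by simp))) < ε := by
  obtain ⟨δ, hδ, hδε⟩ := exists_between hε
  obtain ⟨ψ, hψ, field_close, div_close⟩ :=
    (isWeakDiv w).exists_contDiff_eLpNorm_sub_le Fact.out hp_top (Lp.memLp (field w))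
      (Lp.memLp (div w)) hχ hχ_supp hΩ hU hχU hv (ENNReal.half_pos hδ.ne')
  refine ⟨ψ, hψ, ?_⟩
  rw [edist_comm, ofContDiff, cutoff, edist_ofMemLp]
  exact (ENNReal.add_halves δ ▸ add_le_add field_close div_close).trans_lt hδε

theorem cutoff_mem_closure_smoothFields (hp_top : p ≠ ⊤) (hΩ : IsOpen Ω)
    (hb : Bornology.IsBounded Ω) (hχ : ContDiff ℝ ∞ χ) (hχ_supp : HasCompactSupport χ)
    (hU : IsOpen U) (hχU : tsupport χ ⊆ U) (hv : IsInwardOn Ω U v) (w : WpDiv p Ω) :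
    cutoff hχ hχ_supp w ∈ (smoothFields p Ω).topologicalClosure := by
  have approximable : ∀ ε > 0, ∃ w' ∈ smoothFields p Ω, edist (cutoff hχ hχ_supp w) w' < ε := by
    intro ε hε
    obtain ⟨ψ, hψ, close⟩ :=
      exists_contDiff_edist_cutoff_lt hp_top hΩ hb hχ hχ_supp hU hχU hv w hε
    exact ⟨_, ofContDiff_mem_smoothFields hb hψ, close⟩
  exact EMetric.mem_closure_iff.2 approximable

theorem sum_cutoff_eq {ι : Type*} [Fintype ι] (hΩ : IsOpen Ω) {χ : ι → E3 → ℝ}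
    (hχ : ∀ i, ContDiff ℝ ∞ (χ i)) (hχ_supp : ∀ i, HasCompactSupport (χ i))
    (hχ_sum : ∀ x ∈ Ω, ∑ i, χ i x = 1) (w : WpDiv p Ω) :
    ∑ i, cutoff (hχ i) (hχ_supp i) w = w := by
  refine field_injective hΩ (Lp.ext ?_)
  rw [field_sum]
  filter_upwards [Lp.coeFn_fun_finsetSum Finset.univ fun i => field (cutoff (hχ i) (hχ_supp i) w),
    ae_all_iff.2 fun i => coeFn_field_cutoff (hχ i) (hχ_supp i) w,
    ae_restrict_mem hΩ.measurableSet] with x sum_eq cutoff_eq hx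
  rw [sum_eq, Finset.sum_congr rfl fun i _ => cutoff_eq i, ← Finset.sum_smul, hχ_sum x hx,
    one_smul]

end WpDiv

theorem mainTheorem10_general (Ω : Set E3) (hΩ : IsOpen Ω) (hb : Bornology.IsBounded Ω)
    (hS : SegmentProperty Ω) (p : ℝ≥0∞) [Fact (1 ≤ p)] (hp_top : p ≠ ⊤) :
    (∀ φ ∈ SmoothUpToBoundary Ω, ∃ w : WpDiv p Ω, WpDiv.field w =ᵐ[volume.restrict Ω] φ) ∧
      Dense {w : WpDiv p Ω |
        ∃ φ ∈ SmoothUpToBoundary Ω, WpDiv.field w =ᵐ[volume.restrict Ω] φ} := by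
  refine ⟨fun φ ⟨ψ, hψ, hφψ⟩ => ?_, fun w => ?_⟩
  · have hψ_one : ContDiff ℝ 1 ψ := hψ.of_le (by simp)
    refine ⟨WpDiv.ofContDiff hb hψ_one, (WpDiv.coeFn_field_ofContDiff hb hψ_one).trans ?_⟩
    filter_upwards [ae_restrict_mem hΩ.measurableSet] with x hx
    exact (hφψ (subset_closure hx)).symm
  · choose! U hU hxU v hv using fun x (hx : x ∈ closure Ω) => hS.exists_isInwardOn hΩ hx
    obtain ⟨t, ht, χ, hχ, hχ_supp, hχU, hχ_sum⟩ :=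
      exists_contDiff_partition_of_isCompact hb.isCompact_closure hU hxU
    change w ∈ (WpDiv.smoothFields p Ω).topologicalClosure
    rw [← WpDiv.sum_cutoff_eq hΩ hχ hχ_supp (fun x hx => hχ_sum x (subset_closure hx)) w]
    exact Submodule.sum_mem _ fun i _ => WpDiv.cutoff_mem_closure_smoothFields hp_top hΩ hb (hχ i)
      (hχ_supp i) (hU i (ht i.2)) (hχU i) (hv i (ht i.2)) w

/-- `C^∞(Ω̄)^3` is contained in `W^p(div; Ω)` and is dense in it. -/
theorem mainTheorem10 (Ω : Set E3) (hΩ : IsOpen Ω) (hb : Bornology.IsBounded Ω)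
    (hL : HasLipschitzBoundary Ω) (p : ℝ≥0∞) [Fact (1 ≤ p)] (hp : 1 < p) (hp_top : p ≠ ⊤) :
    (∀ φ ∈ SmoothUpToBoundary Ω, ∃ w : WpDiv p Ω, WpDiv.field w =ᵐ[volume.restrict Ω] φ) ∧
      Dense {w : WpDiv p Ω | ∃ φ ∈ SmoothUpToBoundary Ω, WpDiv.field w =ᵐ[volume.restrict Ω] φ} := by
  exact mainTheorem10_general Ω hΩ hb hL.segmentProperty p hp_top
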